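/- Let $Y$ be a nonempty closed smooth manifold of dimension $2n+1$ ($n\ge 0$) with a co-oriented contact structure $\xi$, and let $\lambda$ be any contact form defining $\xi$ with its co-orientation. The symplectization of $(Y,\xi)$ is $SY=\mathbb R_+\times Y$ with the canonical $1$-form $\theta=r\lambda$; the point $(r,y)$ corresponds to the covector $r\lambda_y\in T_y^*Y$. For contact forms $\alpha,\beta$ on $Y$ defining $\xi$ with its co-orientation: - a *cs-embedding* of $(Y,\alpha)$ is a smooth embedding $\phi:Y\to SY$ with $\phi^*(\theta+\eta)=\alpha$ for some exact, compactly supported smooth $1$-form $\eta$ on $SY$ (that is, $\eta=dh$ has compact support, with $h:SY\to\mathbb R$ smooth); - $W(\beta)=\{p\in SY : 0<p(v)\le\beta(v)\text{ for every tangent vector } v \text{ of } Y \text{ at the base point of } p \text{ with }\beta(v)>0\}$, where $p$ is regarded as a covector; - $\alpha\prec\beta$ means that there is a cs-embedding $\phi$ of $(Y,\alpha)$ with $\phi(Y)\subset W(\beta)$; - $d_{CBM}(\alpha,\beta)=\inf\{\ln C : C\ge 1,\ \alpha\prec C\beta,\ \beta\prec C\alpha\}\in[0,\infty]$, the infimum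 of the empty set being $\infty$. Proposition. Let $\alpha,\beta$ be such contact forms with $\beta=f\alpha$ for a smooth function $f:Y\to(0,\infty)$. Then $$d_{CBM}(\alpha,\beta)\le\max\Big\{\ln\big(\max_Y f\big),\,-\ln\big(\min_Y f\big)\Big\};$$ in particular $d_{CBM}(\alpha,\beta)$ is finite. -/

import Mathlib

open scoped Manifold ContDiff Topology

noncomputable section

/-- The model space `ℝ^(2n+1)` of the odd-dimensional manifold `Y`. -/
abbrev ModelE (n : ℕ) : Type := EuclideanSpace ℝ (Fin (2 * n + 1))

section Forms

variable (n : ℕ) (Y : Type*) [TopologicalSpace Y] [ChartedSpace (ModelE n) Y]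
  [IsManifold 𝓘(ℝ, ModelE n) ∞ Y]

/-- Smooth differential 1-forms on `Y`: smooth sections of the cotangent bundle. -/
abbrev OneForm : Type _ :=
  ContMDiffSection 𝓘(ℝ, ModelE n) (ModelE n →L[ℝ] ℝ) ∞
    (fun y : Y => TangentSpace 𝓘(ℝ, ModelE n) y →L[ℝ] Bundle.Trivial Y ℝ y)

end Forms

section Contact

variable {n : ℕ} {Y : Type*} [TopologicalSpace Y] [ChartedSpace (ModelE n) Y]
  [IsManifold 𝓘(ℝ, ModelE n) ∞ Y]

/-- The 1-form `α` written in the preferred chart at `y`, that is, the pullback of `α` under the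
inverse of this chart (meaningful on the target of the chart). -/
def OneForm.inChart (α : OneForm n Y) (y : Y) (x : ModelE n) : ModelE n →L[ℝ] ℝ :=
  (α ((extChartAt 𝓘(ℝ, ModelE n) y).symm x)).comp
    (mfderiv 𝓘(ℝ, ModelE n) 𝓘(ℝ, ModelE n) (extChartAt 𝓘(ℝ, ModelE n) y).symm x)

/-- The value `dα_y(v, w)` of the exterior derivative of `α`, computed in the preferred chart
at `y`. -/
def OneForm.d (α : OneForm n Y) (y : Y) (v w : TangentSpace 𝓘(ℝ, ModelE n) y) : ℝ :=
  extDeriv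
    (fun x => ContinuousAlternatingMap.ofSubsingleton ℝ (ModelE n) ℝ (0 : Fin 1) (α.inChart y x))
    (extChartAt 𝓘(ℝ, ModelE n) y y)
    ![mfderiv 𝓘(ℝ, ModelE n) 𝓘(ℝ, ModelE n) (extChartAt 𝓘(ℝ, ModelE n) y) y v,
      mfderiv 𝓘(ℝ, ModelE n) 𝓘(ℝ, ModelE n) (extChartAt 𝓘(ℝ, ModelE n) y) y w]

/-- The value of the top-degree form `α ∧ (dα)^n` at `y` on `2n+1` tangent vectors, up to the
positive constant factor coming from the normalisation of the wedge product: the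
antisymmetrisation of `α ⊗ dα ⊗ ⋯ ⊗ dα`. -/
def OneForm.wedgePow (α : OneForm n Y) (y : Y)
    (v : Fin (2 * n + 1) → TangentSpace 𝓘(ℝ, ModelE n) y) : ℝ :=
  ∑ σ : Equiv.Perm (Fin (2 * n + 1)), ((Equiv.Perm.sign σ : ℤ) : ℝ) *
    (α y (v (σ 0)) *
      ∏ i : Fin n, α.d y (v (σ ⟨2 * i.val + 1, by omega⟩)) (v (σ ⟨2 * i.val + 2, by omega⟩)))

/-- `α` is a contact form: `α ∧ (dα)^n` vanishes nowhere. -/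
def IsContactForm (α : OneForm n Y) : Prop :=
  ∀ y : Y, ∃ v : Fin (2 * n + 1) → TangentSpace 𝓘(ℝ, ModelE n) y, α.wedgePow y v ≠ 0

/-- `α` and `β` have the same kernel `ξ` and induce the same co-orientation of `ξ`. -/
def SameCoorientedKernel (α β : OneForm n Y) : Prop :=
  ∀ (y : Y) (v : TangentSpace 𝓘(ℝ, ModelE n) y),
    (α y v = 0 ↔ β y v = 0) ∧ (0 < α y v ↔ 0 < β y v)

end Contact

/-- The open half-line `ℝ₊ = (0, ∞)`, an open submanifold of `ℝ`. -/
def PosReal : TopologicalSpace.Opens ℝ := ⟨Set.Ioi 0, isOpen_Ioi⟩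

/-- The underlying manifold `ℝ₊ × Y` of the symplectization `SY` of `(Y, ξ = ker lam)`. The point
`(r, y)` stands for the covector `r • lam y`, see `Symplectization.covector`. -/
abbrev Symplectization (Y : Type*) : Type _ := PosReal × Y

/-- The model with corners (without boundary) of `ℝ₊ × Y`. -/
abbrev SympModel (n : ℕ) : ModelWithCorners ℝ (ℝ × ModelE n) (ModelProd ℝ (ModelE n)) :=
  𝓘(ℝ, ℝ).prod 𝓘(ℝ, ModelE n)

section Symp

variable {n : ℕ} {Y : Type*} [TopologicalSpace Y] [ChartedSpace (ModelE n) Y]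
  [IsManifold 𝓘(ℝ, ModelE n) ∞ Y]

/-- The fibre over `y` of the symplectization as a subset of the cotangent bundle: the covectors at
`y` whose kernel is `ξ_y = ker (lam y)` and which are positive on the vectors positively transverse
to `ξ_y`. -/
def symplectizationFiber (lam : OneForm n Y) (y : Y) :
    Set (TangentSpace 𝓘(ℝ, ModelE n) y →L[ℝ] ℝ) :=
  {p | p ≠ 0 ∧ ∀ v, (p v = 0 ↔ lam y v = 0) ∧ (0 < lam y v → 0 < p v)}

/-- The covector `r • lam y` at `y` represented by the point `(r, y)` of `SY`. -/
def Symplectization.covector (lam : OneForm n Y) (p : Symplectization Y) :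
    TangentSpace 𝓘(ℝ, ModelE n) p.2 →L[ℝ] ℝ :=
  (p.1 : ℝ) • lam p.2

/-- The canonical (Liouville, tautological) 1-form `θ = r lam` of the symplectization: it evaluates
the covector `p` on the projection to `Y` of a tangent vector at `p`. -/
def Symplectization.theta (lam : OneForm n Y) (p : Symplectization Y) :
    TangentSpace (SympModel n) p →L[ℝ] ℝ :=
  (Symplectization.covector lam p).comp
    (mfderiv (SympModel n) 𝓘(ℝ, ModelE n) (Prod.snd : Symplectization Y → Y) p)

/-- `η` is an exact, compactly supported (smooth) 1-form on `SY`: `η = dh` for a smooth function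
`h` on `SY`, and the support of `η` is compact. -/
def IsExactCompactlySupported
    (η : ∀ p : Symplectization Y, TangentSpace (SympModel n) p →L[ℝ] ℝ) : Prop :=
  (∃ h : Symplectization Y → ℝ, ContMDiff (SympModel n) 𝓘(ℝ, ℝ) ∞ h ∧
    ∀ p, η p = mvfderiv (SympModel n) h p) ∧
  IsCompact (closure {p : Symplectization Y | η p ≠ 0})

/-- `φ` is a cs-embedding of the strict contact manifold `(Y, α)` into `SY`: a smooth embedding with
`φ^*(θ + η) = α` for some exact compactly supported 1-form `η` on `SY`. -/
def IsCSEmbedding (lam α : OneForm n Y) (φ : Y → Symplectization Y) : Prop :=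
  Manifold.IsSmoothEmbedding 𝓘(ℝ, ModelE n) (SympModel n) ∞ φ ∧
  ∃ η : ∀ p : Symplectization Y, TangentSpace (SympModel n) p →L[ℝ] ℝ,
    IsExactCompactlySupported η ∧
    ∀ (y : Y) (v : TangentSpace 𝓘(ℝ, ModelE n) y),
      (Symplectization.theta lam (φ y) + η (φ y))
        (mfderiv 𝓘(ℝ, ModelE n) (SympModel n) φ y v) = α y v

/-- `W(β)`: the points `p` of `SY` with `0 < p(v) ≤ β(v)` for all `v` with `β(v) > 0`. -/
def subgraph (lam β : OneForm n Y) : Set (Symplectization Y) :=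
  {p | ∀ v : TangentSpace 𝓘(ℝ, ModelE n) p.2, 0 < β p.2 v →
    0 < Symplectization.covector lam p v ∧ Symplectization.covector lam p v ≤ β p.2 v}

/-- The relation `α ≺ β`: some cs-embedding of `(Y, α)` into `SY` has image in `W(β)`. -/
def CSPrec (lam α β : OneForm n Y) : Prop :=
  ∃ φ : Y → Symplectization Y, IsCSEmbedding lam α φ ∧ Set.range φ ⊆ subgraph lam β

/-- The contact Banach-Mazur distance: the infimum of `ln C ∈ [0, ∞)` over the constants `C` with
`α ≺ C β` and `β ≺ C α`. It is computed in the extended reals, so that it is `⊤` if there is no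
such `C`. The form `lam` is only used to split the symplectization of `ξ` as `ℝ₊ × Y`. -/
def dCBM (lam α β : OneForm n Y) : EReal :=
  sInf {t : EReal | ∃ C : ℝ, 1 ≤ C ∧ CSPrec lam α (C • β) ∧ CSPrec lam β (C • α) ∧
    t = ((Real.log C : ℝ) : EReal)}

/-- The covectors `r • lam y` with `r > 0` are exactly the fibre over `y` of the symplectization in
the cotangent bundle, and each is represented by exactly one `r`. -/
theorem bijOn_symplectizationFiber (lam : OneForm n Y) (y : Y) (hy : lam y ≠ 0) :
    Set.BijOn (fun r : PosReal => Symplectization.covector lam (r, y)) Set.univ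
      (symplectizationFiber lam y) := by
  obtain ⟨u, hu⟩ : ∃ u, lam y u ≠ 0 := by
    by_contra! hc
    exact hy (ContinuousLinearMap.ext hc)
  obtain ⟨w, hw⟩ : ∃ w, 0 < lam y w := by
    rcases lt_or_gt_of_ne hu with h | h
    · exact ⟨-u, by rw [map_neg]; exact neg_pos.mpr h⟩
    · exact ⟨u, h⟩
  refine ⟨?_, ?_, ?_⟩
  · rintro ⟨r, hr⟩ -
    have hr0 : (0 : ℝ) < r := hr
    have key : ∀ v, Symplectization.covector lam (⟨r, hr⟩, y) v = r * lam y v := fun v => rfl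
    refine ⟨fun h0 => ?_, fun v => ⟨?_, fun hv => ?_⟩⟩
    · have h1 := key w
      have h2 : Symplectization.covector lam (⟨r, hr⟩, y) w = 0 := by
        change Symplectization.covector lam (⟨r, hr⟩, y) = 0 at h0
        rw [h0]; rfl
      rw [h2] at h1
      exact absurd h1.symm (mul_pos hr0 hw).ne'
    · change r * lam y v = 0 ↔ _
      simp [hr0.ne']
    · exact mul_pos hr0 hv
  · rintro ⟨r, hr⟩ - ⟨s, hs⟩ - h
    have h1 : r * lam y w = s * lam y w :=
      congrArg (fun q : TangentSpace 𝓘(ℝ, ModelE n) y →L[ℝ] ℝ => q w) h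
    exact Subtype.ext (mul_right_cancel₀ hw.ne' h1)
  · rintro p ⟨-, hp⟩
    have hpw : 0 < p w := (hp w).2 hw
    refine ⟨⟨p w / lam y w, div_pos hpw hw⟩, trivial, ?_⟩
    refine ContinuousLinearMap.ext fun v => ?_
    change p w / lam y w * lam y v = p v
    have h0 : p (v - (lam y v / lam y w) • w) = 0 := by
      refine ((hp _).1).mpr ?_
      rw [map_sub, map_smul, smul_eq_mul]
      field_simp
      simp
    rw [map_sub, map_smul, smul_eq_mul] at h0
    have h1 := sub_eq_zero.mp h0
    rw [h1]
    ring

end Symp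

end

/-! Every form `α` with the co-oriented kernel of `lam` is `g • lam` for a unique smooth `g > 0`.
The graph `y ↦ (g y, y)` pulls `θ` back to `α`, so it is a cs-embedding with `η = 0`, and it lies in
`W(β)` as soon as `β = c α` with `c ≥ 1` pointwise (`CSPrec.of_eq_smul`). For `C = exp t`, with `t`
the claimed bound, `C β = (C f) α` and `C α = (C / f) β`; both factors are at least `1` because `C ≥
1 / min f` and `C ≥ max f`. So `C` is admissible and the infimum is at most `t`. -/

/-- The composition of a diffeomorphism between manifolds over the same model with a chart in the
maximal atlas of the target lies in the maximal atlas of the source. -/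
theorem Diffeomorph.trans_mem_maximalAtlas {E H M N : Type*} [NormedAddCommGroup E]
    [NormedSpace ℝ E] [TopologicalSpace H] {I : ModelWithCorners ℝ E H}
    [TopologicalSpace M] [ChartedSpace H M] [IsManifold I ∞ M]
    [TopologicalSpace N] [ChartedSpace H N]
    (D : M ≃ₘ^∞⟮I, I⟯ N) {e : OpenPartialHomeomorph N H}
    (he : e ∈ IsManifold.maximalAtlas I ∞ N) :
    D.toHomeomorph.toOpenPartialHomeomorph.trans e ∈ IsManifold.maximalAtlas I ∞ M := by
  rw [IsManifold.mem_maximalAtlas_iff_contMDiffOn]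
  constructor
  · refine (contMDiffOn_of_mem_maximalAtlas he).comp D.contMDiff.contMDiffOn ?_
    intro x hx
    simpa using hx
  · refine D.symm.contMDiff.comp_contMDiffOn
      ((contMDiffOn_symm_of_mem_maximalAtlas he).mono ?_)
    intro x hx
    simpa using hx

/-! ### Graphs of positive functions in the symplectization -/

section Graph

variable {n : ℕ} {Y : Type*} [TopologicalSpace Y] [ChartedSpace (ModelE n) Y]
  [IsManifold 𝓘(ℝ, ModelE n) ∞ Y]

/-- The map `y ↦ (g y, y)`. -/
def symplectizationGraph (g : Y → ℝ) (hg : ∀ y, 0 < g y) (y : Y) : Symplectization Y :=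
  (⟨g y, hg y⟩, y)

omit [IsManifold 𝓘(ℝ, ModelE n) ∞ Y] in
theorem contMDiff_symplectizationGraph {g : Y → ℝ} (hg : ∀ y, 0 < g y)
    (hgs : ContMDiff 𝓘(ℝ, ModelE n) 𝓘(ℝ, ℝ) ∞ g) :
    ContMDiff 𝓘(ℝ, ModelE n) (SympModel n) ∞ (symplectizationGraph g hg) := by
  refine ContMDiff.prodMk ?_ contMDiff_id
  rw [← ContMDiff.subtypeVal_comp_iff]
  exact hgs

/-- The diffeomorphism `(r, y) ↦ (log r - log (g y), y)` which straightens the graph of `g`. -/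
noncomputable def straightenGraph (g : Y → ℝ) (hg : ∀ y, 0 < g y)
    (hgs : ContMDiff 𝓘(ℝ, ModelE n) 𝓘(ℝ, ℝ) ∞ g) :
    (Symplectization Y) ≃ₘ^∞⟮SympModel n, SympModel n⟯ (ℝ × Y) where
  -- The logarithm identifies `ℝ₊` with all of `ℝ`, so the shift by `log g` is onto `ℝ × Y`; the
  -- image of `r - g y` would depend on `y`.
  toFun p := (Real.log p.1.1 - Real.log (g p.2), p.2)
  invFun q := (⟨g q.2 * Real.exp q.1, mul_pos (hg _) (Real.exp_pos _)⟩, q.2)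
  left_inv p := by
    refine Prod.ext (Subtype.ext ?_) rfl
    have h1 : 0 < p.1.1 := p.1.2
    change g p.2 * Real.exp (Real.log p.1.1 - Real.log (g p.2)) = p.1.1
    rw [Real.exp_sub, Real.exp_log h1, Real.exp_log (hg _)]
    have := (hg p.2).ne'
    field_simp
  right_inv q := by
    refine Prod.ext ?_ rfl
    change Real.log (g q.2 * Real.exp q.1) - Real.log (g q.2) = q.1
    rw [Real.log_mul (hg _).ne' (Real.exp_pos _).ne', Real.log_exp]
    ring
  contMDiff_toFun := by
    refine ContMDiff.prodMk ?_ contMDiff_snd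
    have hlog : ∀ {u : Symplectization Y → ℝ}, ContMDiff (SympModel n) 𝓘(ℝ, ℝ) ∞ u →
        (∀ p, 0 < u p) → ContMDiff (SympModel n) 𝓘(ℝ, ℝ) ∞ fun p => Real.log (u p) :=
      fun hu hpos p => ContMDiffAt.comp p
        (Real.contDiffAt_log.2 (hpos p).ne').contMDiffAt (hu p)
    exact (hlog (contMDiff_subtype_val.comp contMDiff_fst) fun p => p.1.2).sub
      (hlog (hgs.comp contMDiff_snd) fun p => hg _)
  contMDiff_invFun := by
    refine ContMDiff.prodMk ?_ contMDiff_snd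
    rw [← ContMDiff.subtypeVal_comp_iff]
    exact (hgs.comp contMDiff_snd).mul (Real.contDiff_exp.contMDiff.comp contMDiff_fst)

omit [IsManifold 𝓘(ℝ, ModelE n) ∞ Y] in
@[simp]
theorem straightenGraph_symplectizationGraph {g : Y → ℝ} (hg : ∀ y, 0 < g y)
    (hgs : ContMDiff 𝓘(ℝ, ModelE n) 𝓘(ℝ, ℝ) ∞ g) (y : Y) :
    straightenGraph g hg hgs (symplectizationGraph g hg y) = (0, y) :=
  Prod.ext (sub_self (Real.log (g y))) rfl

/-- The graph of a smooth positive function is a smooth embedding into the symplectization. -/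
theorem isSmoothEmbedding_symplectizationGraph {g : Y → ℝ} (hg : ∀ y, 0 < g y)
    (hgs : ContMDiff 𝓘(ℝ, ModelE n) 𝓘(ℝ, ℝ) ∞ g) :
    Manifold.IsSmoothEmbedding 𝓘(ℝ, ModelE n) (SympModel n) ∞ (symplectizationGraph g hg) := by
  have hcont := (contMDiff_symplectizationGraph hg hgs).continuous
  refine ⟨Manifold.IsImmersionOfComplement.isImmersion (F := ℝ) fun y => ?_,
    Topology.IsEmbedding.of_leftInverse (f := Prod.snd) (fun _ => rfl) continuous_snd hcont⟩
  -- In the straightened chart the graph reads `u ↦ (0, u)`. The normal form of an immersion is `u ↦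
  -- (u, 0)`, hence the swap `prodComm`.
  refine Manifold.IsImmersionAtOfComplement.mk_of_continuousAt hcont.continuousAt
    (ContinuousLinearEquiv.prodComm ℝ (ModelE n) ℝ) (chartAt (ModelE n) y)
    ((straightenGraph g hg hgs).toHomeomorph.toOpenPartialHomeomorph.trans
      (chartAt (ModelProd ℝ (ModelE n)) ((0 : ℝ), y)))
    (mem_chart_source _ y) ?_ (IsManifold.chart_mem_maximalAtlas y)
    (Diffeomorph.trans_mem_maximalAtlas _ (IsManifold.chart_mem_maximalAtlas _)) ?_
  · simp
  · intro u hu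
    have hu' : u ∈ (chartAt (ModelE n) y).target := by simpa using hu
    simp [chartAt_self_eq, (chartAt (ModelE n) y).right_inv hu']

/-- The pullback of `θ` by the graph of `g` is `g • lam`. -/
theorem theta_symplectizationGraph (lam : OneForm n Y) {g : Y → ℝ} (hg : ∀ y, 0 < g y)
    (hgs : ContMDiff 𝓘(ℝ, ModelE n) 𝓘(ℝ, ℝ) ∞ g) (y : Y)
    (v : TangentSpace 𝓘(ℝ, ModelE n) y) :
    Symplectization.theta lam (symplectizationGraph g hg y)
      (mfderiv 𝓘(ℝ, ModelE n) (SympModel n) (symplectizationGraph g hg) y v) =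
      g y * lam y v := by
  have hd : MDifferentiableAt 𝓘(ℝ, ModelE n) (SympModel n) (symplectizationGraph g hg) y :=
    (contMDiff_symplectizationGraph hg hgs).mdifferentiable (by simp) y
  have hs : MDifferentiableAt (SympModel n) 𝓘(ℝ, ModelE n)
      (Prod.snd : Symplectization Y → Y) (symplectizationGraph g hg y) := mdifferentiableAt_snd
  -- The graph is a section of the projection, so by the chain rule the two derivatives compose to
  -- the identity.
  have hcomp := mfderiv_comp y hs hd
  have hid : (Prod.snd : Symplectization Y → Y) ∘ symplectizationGraph g hg = id := rfl
  rw [hid, mfderiv_id] at hcomp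
  have hv := DFunLike.congr_fun hcomp v
  change g y * lam y (((mfderiv (SympModel n) 𝓘(ℝ, ModelE n) (Prod.snd : Symplectization Y → Y)
    (symplectizationGraph g hg y)).comp
      (mfderiv 𝓘(ℝ, ModelE n) (SympModel n) (symplectizationGraph g hg) y)) v) = _
  exact congrArg (fun w => g y * lam y w) hv.symm

omit [IsManifold 𝓘(ℝ, ModelE n) ∞ Y] in
theorem isExactCompactlySupported_zero :
    IsExactCompactlySupported (n := n) (Y := Y) fun _ => 0 := by
  refine ⟨⟨fun _ => 0, contMDiff_const, fun p => ?_⟩, by simp⟩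
  ext v
  simp [mvfderiv, mfderiv_const]

end Graph

/-! ### Conformal factors between contact forms -/

section Forms

variable {n : ℕ} {Y : Type*} [TopologicalSpace Y] [ChartedSpace (ModelE n) Y]
  [IsManifold 𝓘(ℝ, ModelE n) ∞ Y]

/-- Each term of `α ∧ (dα)^n` contains a factor `α y`, also when `n = 0`. -/
theorem IsContactForm.apply_ne_zero {α : OneForm n Y} (h : IsContactForm α) (y : Y) :
    α y ≠ 0 := by
  intro h0
  obtain ⟨v, hv⟩ := h y
  exact hv (by simp [OneForm.wedgePow, h0])

/-- If `α = g • lam` with `α` and `lam` smooth 1-forms and `lam` vanishing nowhere, then `g` is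
smooth. -/
theorem OneForm.contMDiff_of_eq_smul {lam α : OneForm n Y} (hlam : ∀ y, lam y ≠ 0) {g : Y → ℝ}
    (h : ∀ y, α y = g y • lam y) : ContMDiff 𝓘(ℝ, ModelE n) 𝓘(ℝ, ℝ) ∞ g := by
  intro y₀
  let coord (μ : OneForm n Y) (y : Y) : ModelE n →L[ℝ] ℝ :=
    ContinuousLinearMap.inCoordinates (ModelE n) (TangentSpace 𝓘(ℝ, ModelE n)) ℝ
      (Bundle.Trivial Y ℝ) y₀ y y₀ y (μ y)
  have hsm (μ : OneForm n Y) (v : ModelE n) :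
      ContMDiffAt 𝓘(ℝ, ModelE n) 𝓘(ℝ, ℝ) ∞ (fun y => coord μ y v) y₀ :=
    ((contMDiffAt_hom_bundle _).1 (μ.contMDiff y₀)).2.clm_apply contMDiffAt_const
  have hsmul (y : Y) : coord α y = g y • coord lam y := by
    ext v
    simp [coord, ContinuousLinearMap.inCoordinates, h y]
  -- A fixed vector `v` of the model space on which `lam` is nonzero at `y₀` exhibits `g` near `y₀`
  -- as a quotient of smooth functions.
  obtain ⟨v, hv⟩ : ∃ v, coord lam y₀ v ≠ 0 := by
    by_contra! hc
    refine hlam y₀ (ContinuousLinearMap.ext fun w => ?_)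
    have hb : y₀ ∈ (trivializationAt (ModelE n) (TangentSpace 𝓘(ℝ, ModelE n)) y₀).baseSet :=
      FiberBundle.mem_baseSet_trivializationAt' y₀
    have hw := hc ((trivializationAt (ModelE n) (TangentSpace 𝓘(ℝ, ModelE n))
      y₀).continuousLinearEquivAt ℝ y₀ hb w)
    simp only [coord] at hw
    rw [ContinuousLinearMap.inCoordinates_eq hb
      (FiberBundle.mem_baseSet_trivializationAt' y₀)] at hw
    simpa [Bundle.Trivialization.symm_apply_apply_mk _ hb] using hw
  refine ((hsm α v).div₀ (hsm lam v) hv).congr_of_eventuallyEq ?_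
  filter_upwards [(hsm lam v).continuousAt.eventually_ne hv] with y hy
  change g y = coord α y v / coord lam y v
  rw [hsmul y]
  simp [hy]

/-- Two forms with the same co-oriented kernel differ by a positive factor. -/
theorem SameCoorientedKernel.exists_eq_smul {lam α : OneForm n Y} (hlam : ∀ y, lam y ≠ 0)
    (h : SameCoorientedKernel lam α) : ∃ g : Y → ℝ, (∀ y, 0 < g y) ∧ ∀ y, α y = g y • lam y := by
  have hpt (y : Y) : ∃ c : ℝ, 0 < c ∧ α y = c • lam y := by
    have hα : α y ≠ 0 := fun h0 => hlam y (ContinuousLinearMap.ext fun v =>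
      ((h y v).1).2 (by rw [h0]; rfl))
    -- The factor is the radial coordinate of the covector `α y` in the symplectization.
    obtain ⟨r, -, hr⟩ := (bijOn_symplectizationFiber lam y (hlam y)).surjOn
      (show α y ∈ symplectizationFiber lam y from
        ⟨hα, fun v => ⟨(h y v).1.symm, (h y v).2.1⟩⟩)
    exact ⟨r, r.2, hr.symm⟩
  choose g hg hgα using hpt
  exact ⟨g, hg, hgα⟩

/-- If `α` defines the co-oriented contact structure and `c ≥ 1`, then `α ≺ c • α`. -/
theorem CSPrec.of_eq_smul {lam α β : OneForm n Y} (hlam : ∀ y, lam y ≠ 0)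
    (h : SameCoorientedKernel lam α) {c : Y → ℝ} (hc : ∀ y, 1 ≤ c y)
    (hβ : ∀ y v, β y v = c y * α y v) : CSPrec lam α β := by
  obtain ⟨g, hg, hgα⟩ := h.exists_eq_smul hlam
  have hgs := OneForm.contMDiff_of_eq_smul hlam hgα
  have hgv (y : Y) (v : TangentSpace 𝓘(ℝ, ModelE n) y) : α y v = g y * lam y v := by
    rw [hgα]; rfl
  refine ⟨symplectizationGraph g hg, ⟨isSmoothEmbedding_symplectizationGraph hg hgs,
    fun _ => 0, isExactCompactlySupported_zero, fun y v => ?_⟩, ?_⟩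
  · rw [hgv, ← theta_symplectizationGraph lam hg hgs, add_zero]
  · rintro _ ⟨y, rfl⟩ v hv
    change 0 < g y * lam y v ∧ g y * lam y v ≤ β y v
    change 0 < β y v at hv
    rw [← hgv y v]
    rw [hβ y v] at hv ⊢
    have hα : 0 < α y v := pos_of_mul_pos_right hv (zero_le_one.trans (hc y))
    exact ⟨hα, le_mul_of_one_le_left hα.le (hc y)⟩

end Forms

theorem mainTheorem7 (n : ℕ) (Y : Type*) [TopologicalSpace Y] [ChartedSpace (ModelE n) Y]
    [IsManifold 𝓘(ℝ, ModelE n) ∞ Y] [CompactSpace Y] [T2Space Y] [Nonempty Y]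
    (lam α β : OneForm n Y)
    (hlam : IsContactForm lam) (hα : IsContactForm α) (hβ : IsContactForm β)
    (hlamα : SameCoorientedKernel lam α)
    (f : Y → ℝ) (hf : ContMDiff 𝓘(ℝ, ModelE n) 𝓘(ℝ, ℝ) ∞ f) (hfpos : ∀ y, 0 < f y)
    (hβα : ∀ y, β y = f y • α y) :
    dCBM lam α β ≤
      ((max (Real.log (⨆ y, f y)) (-Real.log (⨅ y, f y)) : ℝ) : EReal) := by

  have hlam0 := hlam.apply_ne_zero
  have hbdA : BddAbove (Set.range f) := (isCompact_range hf.continuous).bddAbove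
  have hbdB : BddBelow (Set.range f) := (isCompact_range hf.continuous).bddBelow
  have hle (y : Y) : f y ≤ ⨆ y, f y := le_ciSup hbdA y
  have hge (y : Y) : ⨅ y, f y ≤ f y := ciInf_le hbdB y
  obtain ⟨y₀⟩ := ‹Nonempty Y›
  -- By compactness the infimum is a value of `f`, hence positive.
  have hm : 0 < ⨅ y, f y := by
    obtain ⟨y₁, -, hy₁⟩ := isCompact_univ.exists_isMinOn ⟨y₀, Set.mem_univ _⟩
      hf.continuous.continuousOn
    have : Nonempty Y := ⟨y₀⟩
    exact (hfpos y₁).trans_le (le_ciInf fun y => hy₁ (Set.mem_univ y))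
  have hM : 0 < ⨆ y, f y := (hfpos y₀).trans_le (hle y₀)
  set t := max (Real.log (⨆ y, f y)) (-Real.log (⨅ y, f y)) with ht
  have hCM : ⨆ y, f y ≤ Real.exp t := by
    rw [← Real.log_le_iff_le_exp hM]
    exact le_max_left _ _
  have hCm : 1 ≤ Real.exp t * ⨅ y, f y := by
    nth_rw 1 [← Real.exp_log hm]
    rw [← Real.exp_add]
    refine Real.one_le_exp ?_
    have := le_max_right (Real.log (⨆ y, f y)) (-Real.log (⨅ y, f y))
    linarith
  -- Needed for `1 ≤ exp t`: if `log (max f) ≤ 0`, then `log (min f) ≤ 0` too.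
  have ht0 : 0 ≤ t := by
    have h1 := Real.log_le_log hm ((hge y₀).trans (hle y₀))
    rcases le_total 0 (Real.log (⨆ y, f y)) with h | h
    · exact h.trans (le_max_left _ _)
    · exact le_max_of_le_right (by linarith)
  have hβv (y : Y) (v : TangentSpace 𝓘(ℝ, ModelE n) y) : β y v = f y * α y v := by
    rw [hβα]; rfl
  have hlamβ : SameCoorientedKernel lam β := fun y v => by
    rw [hβv, mul_eq_zero, mul_pos_iff_of_pos_left (hfpos y), or_iff_right (hfpos y).ne']
    exact hlamα y v
  refine sInf_le ⟨Real.exp t, Real.one_le_exp ht0, ?_, ?_, by rw [Real.log_exp]⟩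
  · refine CSPrec.of_eq_smul hlam0 hlamα (c := fun y => Real.exp t * f y)
      (fun y => hCm.trans (mul_le_mul_of_nonneg_left (hge y) (Real.exp_pos t).le))
      fun y v => ?_
    change Real.exp t * β y v = _
    rw [hβv, mul_assoc]
  · refine CSPrec.of_eq_smul hlam0 hlamβ (c := fun y => Real.exp t / f y)
      (fun y => (one_le_div (hfpos y)).2 ((hle y).trans hCM)) fun y v => ?_
    change Real.exp t * α y v = _
    rw [hβv]
    have := (hfpos y).ne'
    field_simp
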